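/- Let $q=1$ and let $V$ be a finite set of size $n$ (set case), or let $q\ge 2$ be a prime power and let $V$ be an $n$-dimensional vector space over $\mathbb{F}_q$. Let $\mathcal{L}(V)$ be the lattice of all subsets (for $q=1$) or subspaces (for $q\ge 2$) of $V$, with rank $\operatorname{rk}$ given by cardinality or dimension, respectively. Let $\left[{V\atop k}\right]$ be the set of elements of $\mathcal{L}(V)$ of rank $k$, and let $U\mapsto U^\perp$ be a fixed anti-automorphism of the lattice $\mathcal{L}(V)$. For $U\in\mathcal{L}(V)$ let $\boldsymbol{x}_U^{(k)}:\left[{V\atop k}\right]\to\mathbb{R}$ be the characteristic function of $\{K\in\left[{V\atop k}\right] : U\le K\}$. For $0\le i\le\min(k,n-k)$ let $\bar V_i^{(k)}$ be the real span of the functions $\boldsymbol{x}_I^{(k)}$, $I\in\left[{V\atop i}\right]$. These functions are linearly independent, so each $f\in\bar V_i^{(k)}$ has a unique representation $f=\sum_{I}\operatorname{wt}_f^{(i)}(I)\,\boldsymbol{x}_I^{(k)}$; the function $\operatorname{wt}_f^{(i)}:\left[{V\atop i}\right]\to\mathbb{R}$ is the $i$-weight distribution of $f$. For $f:\left[{V\atop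 k}\right]\to\mathbb{R}$ with $0\le k\le n$, the dualized function $f^\perp:\left[{V\atop n-k}\right]\to\mathbb{R}$ is the one induced by the bijection $K\mapsto K^\perp$, that is $f^\perp(K^\perp)=f(K)$ for all $K\in\left[{V\atop k}\right]$ (equivalently $f^\perp(K)=f(K^\perp)$ if $\perp$ is an involution). Put $[m]=1+q+\dots+q^{m-1}$ and ${m\brack z}=\prod_{j=0}^{z-1}\frac{[m-j]}{[z-j]}$, and for integers $0\le z\le i\le m$ let $$\gamma(m,i,z)=\begin{cases}\delta_{z,m} & \text{if } i=m,\\[1ex] \displaystyle(-1)^{i-z}\,\frac{1}{q^{(m-i)(i-z)+\binom{i-z}{2}}}\;\frac{[m-i]}{[m-z]}\;\frac{1}{{m\brack z}} & \text{otherwise.}\end{cases}$$ **Theorem.** Let $0\le k\le n$, $0\le i\le\min(k,n-k)$ and $f\in\bar V_i^{(k)}$. Then $f^\perp\in\bar V_i^{(n-k)}$, and the $i$-weight distribution of $f^\perp$ is given by $$\operatorname{wt}^{(i)}_{f^\perp}(J)=\sum_{I\in\left[{V\atop i}\right]}\gamma\big(n-k,i,\operatorname{rk}(I^\perp\cap J)\big)\,\operatorname{wt}^{(i)}_f(I)\qquad\text{for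 all } J\in\left[{V\atop i}\right].$$ -/

import Mathlib

open scoped BigOperators

/-! Unified treatment of subset lattices (`q = 1`) and subspace lattices (`q` a prime power).
The definitions are made for a finite lattice `L` together with a rank function `rk : L → ℕ`;
they are used for `L = Finset V`, `rk = card` and for `L = Submodule F V`, `rk = dim`. -/

namespace DualWeights

/-- The `q`-number `[n]_q = 1 + q + ⋯ + q ^ (n - 1)`. -/
def qNum (q : ℝ) (n : ℕ) : ℝ := ∑ j ∈ Finset.range n, q ^ j

/-- The falling `q`-factorial `[n]_q [n - 1]_q ⋯ [n - k + 1]_q`. For `k > n` it is `0`, since the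
factor `[0]_q = 0` occurs. -/
def qFalling (q : ℝ) (n k : ℕ) : ℝ := ∏ j ∈ Finset.range k, qNum q (n - j)

/-- The `q`-factorial `[k]_q!`. -/
def qFact (q : ℝ) (k : ℕ) : ℝ := qFalling q k k

/-- The Gaussian binomial coefficient. -/
noncomputable def qBinom (q : ℝ) (n k : ℕ) : ℝ := qFalling q n k / qFact q k

/-- The coefficients `γ(k, i, z)`, of interest for `0 ≤ z ≤ i ≤ k`; then no subtraction
truncates and no denominator vanishes. -/
noncomputable def gammaCoeff (q : ℝ) (k i z : ℕ) : ℝ :=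
  if i = k then (if z = k then 1 else 0)
  else (-1) ^ (i - z) * (1 / q ^ ((k - i) * (i - z) + (i - z).choose 2))
    * (qNum q (k - i) / qNum q (k - z)) * (1 / qBinom q k z)

section Lattice

variable {L : Type*} [Lattice L]

/-- The elements of rank `k`, that is the subsets of size `k` or the subspaces of dimension `k`. -/
def Grass (rk : L → ℕ) (k : ℕ) : Type _ := {U : L // rk U = k}

noncomputable instance [Finite L] (rk : L → ℕ) (k : ℕ) : Fintype (Grass rk k) :=
  haveI : Finite (Grass rk k) := Subtype.finite
  Fintype.ofFinite _

open Classical in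
/-- The characteristic function `x_U^{(k)}` of the pencil of all elements of rank `k` above `U`. -/
noncomputable def pencil (rk : L → ℕ) (k : ℕ) (U : L) : Grass rk k → ℝ :=
  fun K => if U ≤ K.1 then 1 else 0

/-- The space spanned by the `i`-pencils in the space of real functions on the elements
of rank `k`. -/
noncomputable def Vbar (rk : L → ℕ) (i k : ℕ) : Submodule ℝ (Grass rk k → ℝ) :=
  Submodule.span ℝ (Set.range fun I : Grass rk i => pencil rk k I.1)

open Classical in
/-- The `i`-weight distribution of `f`: the coefficients `a` in `f = ∑ I, a I • x_I^{(k)}`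
(unique when `i ≤ k ≤ n - i`). The default value `0` is taken only outside `Vbar rk i k`. -/
noncomputable def wt [Finite L] (rk : L → ℕ) (i k : ℕ) (f : Grass rk k → ℝ) : Grass rk i → ℝ :=
  if h : ∃ a : Grass rk i → ℝ, f = ∑ I : Grass rk i, a I • pencil rk k I.1
  then h.choose else 0

theorem sum_wt_smul_pencil [Finite L] (rk : L → ℕ) (i k : ℕ) (f : Grass rk k → ℝ)
    (hf : f ∈ Vbar rk i k) : f = ∑ I : Grass rk i, wt rk i k f I • pencil rk k I.1 := by
  have h : ∃ a : Grass rk i → ℝ, f = ∑ I : Grass rk i, a I • pencil rk k I.1 := by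
    obtain ⟨a, ha⟩ := (Submodule.mem_span_range_iff_exists_fun ℝ).mp hf
    exact ⟨a, ha.symm⟩
  simp only [wt, dif_pos h]
  exact h.choose_spec

/-- `U^⊥` for an anti-automorphism `σ` of the lattice `L`. -/
def perp (σ : L ≃o Lᵒᵈ) (U : L) : L := OrderDual.ofDual (σ U)

/-- The inverse map of `U ↦ U^⊥`. -/
def perpInv (σ : L ≃o Lᵒᵈ) (U : L) : L := σ.symm (OrderDual.toDual U)

@[simp] theorem perp_perpInv (σ : L ≃o Lᵒᵈ) (U : L) : perp σ (perpInv σ U) = U := by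
  simp [perp, perpInv]

@[simp] theorem perpInv_perp (σ : L ≃o Lᵒᵈ) (U : L) : perpInv σ (perp σ U) = U := by
  simp [perp, perpInv]

/-- The function on the elements of rank `n - k` that is induced by `f` through the bijection
`K ↦ K^⊥`, that is `f^⊥ (K^⊥) = f K`; see `dualFun_perp` and `dualFun_of_involutive`. -/
def dualFun {rk : L → ℕ} {n : ℕ} (σ : L ≃o Lᵒᵈ) (hσ : ∀ U, rk (perp σ U) + rk U = n)
    {k : ℕ} (hk : k ≤ n) (f : Grass rk k → ℝ) : Grass rk (n - k) → ℝ :=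
  fun K => f ⟨perpInv σ K.1, by
    have h1 := hσ (perpInv σ K.1)
    have h2 := K.2
    rw [perp_perpInv] at h1
    omega⟩

theorem dualFun_perp {rk : L → ℕ} {n : ℕ} (σ : L ≃o Lᵒᵈ)
    (hσ : ∀ U, rk (perp σ U) + rk U = n) {k : ℕ} (hk : k ≤ n) (f : Grass rk k → ℝ)
    (K : Grass rk k) (hK : rk (perp σ K.1) = n - k) :
    dualFun σ hσ hk f ⟨perp σ K.1, hK⟩ = f K := by
  obtain ⟨K, h⟩ := K
  simp [dualFun]

/-- If `U^⊥^⊥ = U` for all `U`, then `f^⊥ (K) = f (K^⊥)`. -/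
theorem dualFun_of_involutive {rk : L → ℕ} {n : ℕ} (σ : L ≃o Lᵒᵈ)
    (hσ : ∀ U, rk (perp σ U) + rk U = n) {k : ℕ} (hk : k ≤ n) (f : Grass rk k → ℝ)
    (hinv : ∀ U, perp σ (perp σ U) = U) (K : Grass rk (n - k)) (hK : rk (perp σ K.1) = k) :
    dualFun σ hσ hk f K = f ⟨perp σ K.1, hK⟩ := by
  have h : perpInv σ K.1 = perp σ K.1 := by
    conv_lhs => rw [← hinv K.1]
    rw [perpInv_perp]
  simp [dualFun, h]

/-- An anti-automorphism of a finite graded lattice exchanges rank and corank. -/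
theorem rk_perp_add [BoundedOrder L] [Finite L] (rk : L → ℕ) (h0 : rk ⊥ = 0)
    (hc : ∀ a b : L, a ⋖ b → rk b = rk a + 1) (σ : L ≃o Lᵒᵈ) (U : L) :
    rk (perp σ U) + rk U = rk ⊤ := by
  induction U using WellFoundedLT.induction with
  | ind U ih =>
    by_cases hU : U = ⊥
    · subst hU
      simp [perp, h0]
    · obtain ⟨W, -, hW⟩ := exists_le_covBy_of_lt (bot_lt_iff_ne_bot.mpr hU)
      have h1 := ih W hW.lt
      have h2 : perp σ U ⋖ perp σ W := by
        have h3 : σ W ⋖ σ U := (apply_covBy_apply_iff σ).mpr hW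
        exact h3.ofDual
      have h4 := hc _ _ h2
      have h5 := hc _ _ hW
      omega

end Lattice

/-- Rank and corank in the lattice of subsets of a finite set. -/
theorem card_perp_add {V : Type*} [Fintype V] [DecidableEq V] (σ : Finset V ≃o (Finset V)ᵒᵈ)
    (U : Finset V) : (perp σ U).card + U.card = Fintype.card V := by
  have h := rk_perp_add (L := Finset V) Finset.card (by simp) (fun a b hab => by
    have := hab.card_finset
    rw [Nat.covBy_iff_add_one_eq] at this
    exact this.symm) σ U
  simpa using h

/-- The rank function `dim` on the lattice of subspaces. -/
noncomputable abbrev dimRk (F V : Type*) [Field F] [AddCommGroup V] [Module F V] :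
    Submodule F V → ℕ := fun U => Module.finrank F U

/-- The rank function `#` on the lattice of subsets. -/
abbrev cardRk (V : Type*) : Finset V → ℕ := Finset.card

/-- Rank and corank in the lattice of subsets of a finite set. -/
theorem cardRk_perp_add {V : Type*} [Fintype V] [DecidableEq V] (σ : Finset V ≃o (Finset V)ᵒᵈ)
    (U : Finset V) : cardRk V (perp σ U) + cardRk V U = Fintype.card V := by
  have h := rk_perp_add (cardRk V) (by simp) (fun a b hab => by
    have := hab.card_finset
    rw [Nat.covBy_iff_add_one_eq] at this
    exact this.symm) σ U
  simpa using h

/-- Rank and corank in the lattice of subspaces of a finite vector space. -/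
theorem dimRk_perp_add {F V : Type*} [Field F] [AddCommGroup V] [Module F V] [Finite V]
    (σ : Submodule F V ≃o (Submodule F V)ᵒᵈ) (U : Submodule F V) :
    dimRk F V (perp σ U) + dimRk F V U = Module.finrank F V := by
  have : Module.Finite F V := Module.Finite.of_finite
  have h := rk_perp_add (dimRk F V) (by simp)
    (fun a b hab => by
      obtain ⟨v, hvb, hva⟩ := SetLike.exists_of_lt hab.lt
      have hv0 : v ≠ 0 := fun h => hva (h ▸ a.zero_mem)
      have h1 : a ⊔ Submodule.span F {v} = b := by
        refine (hab.eq_or_eq le_sup_left (sup_le hab.le ?_)).resolve_left ?_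
        · simpa using hvb
        · intro h
          exact hva (h ▸ (le_sup_right : _ ≤ a ⊔ Submodule.span F {v})
            (Submodule.mem_span_singleton_self v))
      have h2 := Submodule.finrank_add_le_finrank_add_finrank a (Submodule.span F {v})
      have h3 := finrank_span_singleton (K := F) hv0
      have h4 := Submodule.finrank_lt_finrank_of_lt hab.lt
      rw [h1] at h2
      change Module.finrank F b = Module.finrank F a + 1
      omega) σ U
  simpa using h

end DualWeights

open DualWeights

/-! Put m = n - k. Since K ≤ I^⊥ holds exactly when the preimage of K under ⊥ lies above I,
dualizing x_I gives the indicator of {K : K ≤ I^⊥}. Everything rests on expanding this indicator in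
i-pencils (`sum_gammaCoeff`): for rk K = m and rk (W ⊓ K) ≥ m - i, the sum of γ(m, i, rk (W ⊓ J))
over J ≤ K of rank i is 1 if K ≤ W and 0 otherwise. For W = I^⊥, of rank n - i, the modular law
supplies the rank bound.

The hard case is the vanishing for D = W ⊓ K < K with i < m. There γ is spread over the pairs J' ⋖ J
by `gammaFlow`: summing over J' returns γ (`sum_gammaFlow_lower`), summing over J gives 0
(`sum_gammaFlow_upper`), so exchanging the sums proves the claim.

The same expansion yields a left inverse of the square inclusion matrix in an interval of rank m +
i, hence linear independence of the pencils and uniqueness of weights. Both lattices enter only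
through `IsQGraded` and modularity. -/

namespace DualWeights

/-! ### Identities for q-numbers and the coefficients γ. -/

section QNumbers

variable {q : ℝ}

@[simp] theorem qNum_zero (q : ℝ) : qNum q 0 = 0 := by simp [qNum]

@[simp] theorem qNum_one (q : ℝ) : qNum q 1 = 1 := by simp [qNum]

theorem qNum_add (q : ℝ) (a b : ℕ) : qNum q (a + b) = qNum q a + q ^ a * qNum q b := by
  simp [qNum, Finset.sum_range_add, Finset.mul_sum, pow_add]

theorem sub_one_mul_qNum (q : ℝ) (a : ℕ) : (q - 1) * qNum q a = q ^ a - 1 :=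
  mul_geom_sum q a

theorem qNum_pos (hq : 0 < q) {a : ℕ} (ha : 0 < a) : 0 < qNum q a :=
  Finset.sum_pos (fun _ _ => pow_pos hq _) ⟨0, Finset.mem_range.mpr ha⟩

theorem qNum_ne_zero (hq : 0 < q) {a : ℕ} (ha : 0 < a) : qNum q a ≠ 0 := (qNum_pos hq ha).ne'

/-- The identity that closes the sum over lower covers in `sum_gammaFlow_lower`. -/
theorem qNum_add_mul_qNum_add (q : ℝ) (x j y : ℕ) :
    qNum q (x + j) * qNum q (x + y)
      = q ^ x * qNum q j * qNum q y + qNum q (x + y + j) * qNum q x := by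
  have hx := sub_one_mul_qNum q x
  have hy := sub_one_mul_qNum q y
  simp only [qNum_add, pow_add]
  linear_combination (-q ^ x * qNum q j * qNum q y) * hx + q ^ x * qNum q x * qNum q j * hy

theorem qFalling_succ (q : ℝ) (n k : ℕ) :
    qFalling q n (k + 1) = qFalling q n k * qNum q (n - k) := by
  simp [qFalling, Finset.prod_range_succ]

theorem qFact_succ (q : ℝ) (k : ℕ) : qFact q (k + 1) = qNum q (k + 1) * qFact q k := by
  simp [qFact, qFalling, Finset.prod_range_succ', mul_comm]

theorem qFalling_pos (hq : 0 < q) {n k : ℕ} (h : k ≤ n) : 0 < qFalling q n k :=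
  Finset.prod_pos fun j hj => qNum_pos hq (by have := Finset.mem_range.mp hj; omega)

theorem qFact_pos (hq : 0 < q) (k : ℕ) : 0 < qFact q k := qFalling_pos hq le_rfl

theorem qFalling_mul_qFact (q : ℝ) (a b : ℕ) :
    qFalling q (a + b) a * qFact q b = qFact q (a + b) := by
  induction a with
  | zero => simp [qFalling]
  | succ a ih =>
    have h1 : qFalling q (a + 1 + b) (a + 1) = qNum q (a + 1 + b) * qFalling q (a + b) a := by
      rw [qFalling, Finset.prod_range_succ', mul_comm, qFalling]
      congr 1
      refine Finset.prod_congr rfl fun j _ => ?_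
      congr 1
      omega
    rw [h1, mul_assoc, ih, show a + 1 + b = a + b + 1 by ring, qFact_succ]

theorem qBinom_add_symm (hq : 0 < q) (a b : ℕ) : qBinom q (a + b) a = qBinom q (a + b) b := by
  have h1 := qFalling_mul_qFact q a b
  have h2 := qFalling_mul_qFact q b a
  rw [add_comm b a] at h2
  rw [qBinom, qBinom, div_eq_div_iff (qFact_pos hq a).ne' (qFact_pos hq b).ne', h1, h2]

theorem gammaCoeff_self_right (hq : 0 < q) {m i : ℕ} (h : i < m) :
    gammaCoeff q m i i = 1 / qBinom q m i := by
  have := qNum_ne_zero hq (Nat.sub_pos_of_lt h)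
  simp [gammaCoeff, h.ne, this]

/-- Ratio of consecutive coefficients: the exponent of q drops by (m - i) + (i - z - 1) = m - (z +
1), and the factor [m - z] cancels against the one from the Gaussian binomials. -/
theorem gammaCoeff_mul_qNum_succ (hq : 0 < q) {m i z : ℕ} (hz : z + 1 ≤ i) (hi : i < m) :
    gammaCoeff q m i z * qNum q (z + 1) * q ^ (m - (z + 1))
      = -(gammaCoeff q m i (z + 1) * qNum q (m - (z + 1))) := by
  obtain ⟨j, rfl⟩ := Nat.exists_eq_add_of_le hz
  obtain ⟨a, rfl⟩ := Nat.exists_eq_add_of_lt hi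
  have e1 : z + 1 + j - z = j + 1 := by omega
  have e2 : z + 1 + j - (z + 1) = j := by omega
  have e3 : z + 1 + j + a + 1 - (z + 1 + j) = a + 1 := by omega
  have e4 : z + 1 + j + a + 1 - (z + 1) = a + 1 + j := by omega
  have e5 : z + 1 + j + a + 1 - z = a + 1 + j + 1 := by omega
  have hc : (j + 1).choose 2 = j.choose 2 + j := by
    rw [Nat.choose_succ_succ' j 1, Nat.choose_one_right, add_comm]
  have h1 := (qFalling_pos hq (show z ≤ z + 1 + j + a + 1 by omega)).ne'
  have h2 := (qFact_pos hq z).ne'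
  have h3 := qNum_ne_zero hq (Nat.succ_pos z)
  have h4 := qNum_ne_zero hq (Nat.succ_pos (a + 1 + j))
  have h5 := qNum_ne_zero hq (show 0 < a + 1 + j by omega)
  have h6 := hq.ne'
  simp only [gammaCoeff, if_neg hi.ne, qBinom, qFalling_succ, qFact_succ, e1, e2, e3, e4, e5, hc]
  simp only [Nat.succ_eq_add_one] at h3 h4
  field_simp
  ring

end QNumbers

/-! ### Counting and modularity in q-graded lattices. -/

section Graded

variable {L : Type*} [Lattice L]

/-- The elements of rank `r` in the interval `[a, b]`. -/
noncomputable def layer [Finite L] (rk : L → ℕ) (a b : L) (r : ℕ) : Finset L :=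
  (Set.toFinite {c | a ≤ c ∧ c ≤ b ∧ rk c = r}).toFinset

@[simp] theorem mem_layer [Finite L] {rk : L → ℕ} {a b c : L} {r : ℕ} :
    c ∈ layer rk a b r ↔ a ≤ c ∧ c ≤ b ∧ rk c = r := by
  simp [layer]

/-- A rank function with the modular law for which each `a ≤ b` has exactly
`[rk b - rk a]_q` elements of rank `rk a + 1` in the interval `[a, b]`. -/
structure IsQGraded [OrderBot L] [Finite L] (q : ℝ) (rk : L → ℕ) : Prop where
  rk_bot : rk ⊥ = 0
  strictMono : StrictMono rk
  rk_sup_add_rk_inf : ∀ a b, rk (a ⊔ b) + rk (a ⊓ b) = rk a + rk b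
  card_layer_succ : ∀ a b, a ≤ b → ((layer rk a b (rk a + 1)).card : ℝ) = qNum q (rk b - rk a)

theorem sum_layer_comm [Finite L] {M : Type*} [AddCommMonoid M] (rk : L → ℕ) (a b : L) (r s : ℕ)
    (h : L → L → M) :
    ∑ c ∈ layer rk a b s, ∑ c' ∈ layer rk a c r, h c' c
      = ∑ c' ∈ layer rk a b r, ∑ c ∈ layer rk c' b s, h c' c := by
  refine Finset.sum_comm' fun c c' => ?_
  simp only [mem_layer]
  exact ⟨fun ⟨⟨_, h2, h3⟩, h4, h5, h6⟩ => ⟨⟨h5, h2, h3⟩, h4, h5.trans h2, h6⟩,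
    fun ⟨⟨h1, h2, h3⟩, h4, _, h6⟩ => ⟨⟨h4.trans h1, h2, h3⟩, h4, h1, h6⟩⟩

theorem inf_eq_inf_of_inf_le {a b D : L} (hab : a ≤ b) (h : D ⊓ b ≤ a) : D ⊓ b = D ⊓ a :=
  le_antisymm (le_inf inf_le_left h) (inf_le_inf_left D hab)

namespace IsQGraded

variable [OrderBot L] [Finite L] {q : ℝ} {rk : L → ℕ}

theorem eq_of_le (H : IsQGraded q rk) {a b : L} (h : a ≤ b) (hr : rk b ≤ rk a) : a = b := by
  by_contra hne
  exact absurd (H.strictMono (lt_of_le_of_ne h hne)) (by omega)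

theorem layer_self (H : IsQGraded q rk) (a b : L) (h : a ≤ b) : layer rk a b (rk b) = {b} := by
  ext c
  simp only [mem_layer, Finset.mem_singleton]
  exact ⟨fun ⟨_, h2, h3⟩ => H.eq_of_le h2 h3.ge, by rintro rfl; exact ⟨h, le_rfl, rfl⟩⟩

theorem layer_bot_zero (H : IsQGraded q rk) (b : L) : layer rk ⊥ b 0 = {⊥} := by
  ext c
  simp only [mem_layer, Finset.mem_singleton]
  exact ⟨fun ⟨h1, _, h3⟩ => (H.eq_of_le h1 (by omega)).symm,
    by rintro rfl; exact ⟨le_rfl, bot_le, H.rk_bot⟩⟩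

theorem layer_rk_self (H : IsQGraded q rk) (a b : L) (h : a ≤ b) : layer rk a b (rk a) = {a} := by
  ext c
  simp only [mem_layer, Finset.mem_singleton]
  exact ⟨fun ⟨h1, _, h3⟩ => (H.eq_of_le h1 h3.le).symm, by rintro rfl; exact ⟨le_rfl, h, rfl⟩⟩

/-- The number of elements of `[a, b]` of corank `1` is also `[rk b - rk a]_q`. -/
theorem card_layer_pred (hq : 0 < q) (H : IsQGraded q rk) {a b : L} (hab : a ≤ b) {r : ℕ}
    (hr : r + 1 = rk b) : ((layer rk a b r).card : ℝ) = qNum q (rk b - rk a) := by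
  induction hd : rk b - rk a generalizing a with
  | zero =>
    have h1 := H.strictMono.monotone hab
    have : layer rk a b r = ∅ := by
      ext c
      simp only [mem_layer, Finset.notMem_empty, iff_false]
      rintro ⟨h2, _, h3⟩
      have := H.strictMono.monotone h2
      omega
    simp [this]
  | succ d ih =>
    rcases Nat.eq_zero_or_pos d with rfl | hd0
    · have : r = rk a := by omega
      rw [this, H.layer_rk_self a b hab]
      simp
    -- Count incident pairs of an atom and a coatom of [a, b]: each is incident with [d] of the
    -- other kind, so they are equally many.
    have key := sum_layer_comm rk a b (rk a + 1) r fun _ _ => (1 : ℝ)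
    simp only [Finset.sum_const, nsmul_eq_mul, mul_one] at key
    rw [Finset.sum_congr rfl (g := fun _ => qNum q d), Finset.sum_congr (s₁ := layer rk a b (rk a + 1))
      rfl (g := fun _ => qNum q d)] at key
    · simp only [Finset.sum_const, nsmul_eq_mul] at key
      rw [H.card_layer_succ a b hab, hd] at key
      exact mul_right_cancel₀ (qNum_ne_zero hq hd0) key
    · intro c hc
      obtain ⟨_, h2, h3⟩ := mem_layer.mp hc
      exact ih h2 (by omega)
    · intro c hc
      obtain ⟨h1, _, h3⟩ := mem_layer.mp hc
      rw [H.card_layer_succ a c h1]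
      congr 1
      omega

theorem card_layer_bot (hq : 0 < q) (H : IsQGraded q rk) (K : L) {i : ℕ} (hi : i ≤ rk K) :
    ((layer rk ⊥ K i).card : ℝ) = qBinom q (rk K) i := by
  induction i with
  | zero => simp [H.layer_bot_zero, qBinom, qFact, qFalling]
  | succ i ih =>
    -- Counting covering pairs of ranks i, i + 1 gives the recursion of the Gaussian binomials.
    have key := sum_layer_comm rk ⊥ K i (i + 1) fun _ _ => (1 : ℝ)
    simp only [Finset.sum_const, nsmul_eq_mul, mul_one] at key
    rw [Finset.sum_congr rfl (g := fun _ => qNum q (i + 1)),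
      Finset.sum_congr (s₁ := layer rk ⊥ K i) rfl (g := fun _ => qNum q (rk K - i))] at key
    · simp only [Finset.sum_const, nsmul_eq_mul] at key
      rw [ih (by omega), qBinom] at key
      rw [qBinom, qFalling_succ, qFact_succ]
      have h1 := (qFact_pos hq i).ne'
      have h2 := qNum_ne_zero hq (Nat.succ_pos i)
      simp only [Nat.succ_eq_add_one] at h2
      field_simp at key ⊢
      linear_combination key
    · intro c hc
      obtain ⟨_, h2, h3⟩ := mem_layer.mp hc
      rw [← h3, H.card_layer_succ c K h2]
    · intro c hc
      obtain ⟨_, _, h3⟩ := mem_layer.mp hc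
      rw [H.card_layer_pred hq bot_le h3.symm, H.rk_bot, h3, Nat.sub_zero]

theorem exists_le_rk_eq (hq : 0 < q) (H : IsQGraded q rk) {a b : L} (hab : a ≤ b) {r : ℕ}
    (h1 : rk a ≤ r) (h2 : r ≤ rk b) : ∃ c, a ≤ c ∧ c ≤ b ∧ rk c = r := by
  induction r, h1 using Nat.le_induction with
  | base => exact ⟨a, le_rfl, hab, rfl⟩
  | succ r _ ih =>
    obtain ⟨c, hac, hcb, hc⟩ := ih (by omega)
    have h3 : (0 : ℝ) < (layer rk c b (rk c + 1)).card := by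
      rw [H.card_layer_succ c b hcb]
      exact qNum_pos hq (by omega)
    obtain ⟨x, hx⟩ := Finset.card_pos.mp (Nat.cast_pos.mp h3)
    obtain ⟨h4, h5, h6⟩ := mem_layer.mp hx
    exact ⟨x, hac.trans h4, h5, by omega⟩

/-- By modularity a ⊔ (D ⊓ b) = (a ⊔ D) ⊓ b lies between a and its cover b, so it equals one of
them. This makes the covers of a that enlarge the meet with D countable: they are the atoms of [a, a
⊔ D]. -/
theorem le_sup_iff [IsModularLattice L] (H : IsQGraded q rk) {a b D : L} (hab : a ≤ b) (hr : rk b = rk a + 1) :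
    b ≤ a ⊔ D ↔ ¬ D ⊓ b ≤ a := by
  have hm : a ⊔ D ⊓ b = (a ⊔ D) ⊓ b := (sup_inf_assoc_of_le D hab).symm
  constructor
  · intro h h'
    rw [inf_eq_right.mpr h, sup_eq_left.mpr h'] at hm
    rw [hm] at hr
    omega
  · intro h
    have h1 : a < a ⊔ D ⊓ b := lt_of_le_of_ne le_sup_left fun e => h (sup_eq_left.mp e.symm)
    have h2 := H.strictMono h1
    have h3 : a ⊔ D ⊓ b = b := H.eq_of_le (sup_le hab inf_le_right) (by omega)
    rw [h3] at hm
    exact inf_eq_right.mp hm.symm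

theorem rk_inf_of_not_le (H : IsQGraded q rk) {a b D : L} (hab : a ≤ b) (hr : rk b = rk a + 1)
    (h : ¬ D ⊓ b ≤ a) : rk (D ⊓ b) = rk (D ⊓ a) + 1 := by
  have h1 : a < a ⊔ D ⊓ b := lt_of_le_of_ne le_sup_left fun e => h (sup_eq_left.mp e.symm)
  have h2 := H.strictMono h1
  have h3 : a ⊔ D ⊓ b = b := H.eq_of_le (sup_le hab inf_le_right) (by omega)
  have h4 := H.rk_sup_add_rk_inf a (D ⊓ b)
  have h5 : a ⊓ (D ⊓ b) = D ⊓ a := by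
    rw [inf_left_comm, inf_eq_left.mpr hab]
  rw [h3, h5] at h4
  omega

end IsQGraded

end Graded

/-! ### The expansion of the indicator of K ≤ W. -/

namespace IsQGraded

variable {L : Type*} [Lattice L] [OrderBot L] [Finite L] {q : ℝ} {rk : L → ℕ}

open Classical in
/-- A local term for the pair `J' ⋖ J`; these terms sum to `γ` over the lower covers `J'` of `J`
and to `0` over the upper covers `J` of `J'` below `K`. -/
noncomputable def gammaFlow (q : ℝ) (rk : L → ℕ) (D K : L) (i : ℕ) (J' J : L) : ℝ :=
  gammaCoeff q (rk K) (i + 1) (rk (D ⊓ J')) * q ^ (rk K - rk D + rk (D ⊓ J'))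
    / (q ^ (i + 1) * qNum q (rk K - rk D) * qNum q (rk K - (i + 1)))
    * (if D ⊓ J ≤ J' then qNum q (rk D - rk (D ⊓ J'))
        else -(qNum q (rk K - i) - qNum q (rk D - rk (D ⊓ J'))))

/-- The prefactor depends only on J'. With s = [rk D - rk (D ⊓ J')] and t = [rk K - i], exactly s of
the t covers J lie below J' ⊔ D and carry -(t - s); the other t - s carry s. -/
theorem sum_gammaFlow_upper [IsModularLattice L] (H : IsQGraded q rk) {D K : L} (hD : D ≤ K) {i : ℕ}
    {J' : L} (hJ' : J' ∈ layer rk ⊥ K i) :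
    ∑ J ∈ layer rk J' K (i + 1), gammaFlow q rk D K i J' J = 0 := by
  classical
  obtain ⟨_, hK, hi⟩ := mem_layer.mp hJ'
  have hcard := H.card_layer_succ J' K hK
  have hcard' := H.card_layer_succ J' (J' ⊔ D) le_sup_left
  have hrk := H.rk_sup_add_rk_inf J' D
  rw [inf_comm] at hrk
  have hle := H.strictMono.monotone (inf_le_left : D ⊓ J' ≤ D)
  have hle' := H.strictMono.monotone (inf_le_right : D ⊓ J' ≤ J')
  rw [show rk (J' ⊔ D) - rk J' = rk D - rk (D ⊓ J') by omega] at hcard'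
  have hfilter : (layer rk J' K (i + 1)).filter (fun J => ¬ D ⊓ J ≤ J')
      = layer rk J' (J' ⊔ D) (i + 1) := by
    ext J
    simp only [Finset.mem_filter, mem_layer]
    constructor
    · rintro ⟨⟨h1, _, h3⟩, h4⟩
      exact ⟨h1, (H.le_sup_iff h1 (by omega)).mpr h4, h3⟩
    · rintro ⟨h1, h2, h3⟩
      exact ⟨⟨h1, h2.trans (sup_le hK hD), h3⟩, (H.le_sup_iff h1 (by omega)).mp h2⟩
  have hsplit := Finset.card_filter_add_card_filter_not (s := layer rk J' K (i + 1))
    (fun J => D ⊓ J ≤ J')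
  rw [hfilter] at hsplit
  have hsplit' := congrArg (Nat.cast (R := ℝ)) hsplit
  push_cast at hsplit'
  rw [hi] at hcard hcard'
  rw [hcard, hcard'] at hsplit'
  simp only [gammaFlow]
  rw [← Finset.mul_sum, Finset.sum_ite, hfilter]
  simp only [Finset.sum_const, nsmul_eq_mul]
  rw [hcard']
  linear_combination (gammaCoeff q (rk K) (i + 1) (rk (D ⊓ J')) * q ^ (rk K - rk D + rk (D ⊓ J'))
    / (q ^ (i + 1) * qNum q (rk K - rk D) * qNum q (rk K - (i + 1)))
    * qNum q (rk D - rk (D ⊓ J'))) * hsplit'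

/-- With z = rk (D ⊓ J), the [i + 1 - z] lower covers above D ⊓ J keep the rank z of the meet, all
others lower it to z - 1. So only two values of γ occur, and their ratio is known. -/
theorem sum_gammaFlow_lower (hq : 0 < q) (H : IsQGraded q rk) {D K : L} (hD : D ≤ K) {i : ℕ}
    (hi : i + 1 < rk K) (hlt : rk D < rk K) (hcodim : rk K ≤ rk D + (i + 1))
    {J : L} (hJ : J ∈ layer rk ⊥ K (i + 1)) :
    ∑ J' ∈ layer rk ⊥ J i, gammaFlow q rk D K i J' J
      = gammaCoeff q (rk K) (i + 1) (rk (D ⊓ J)) := by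
  classical
  obtain ⟨_, hK, hr⟩ := mem_layer.mp hJ
  set m := rk K with hm
  set d := rk D with hd
  set z := rk (D ⊓ J) with hz
  have hcard := H.card_layer_pred hq (bot_le : ⊥ ≤ J) hr.symm
  have hcard' := H.card_layer_pred hq (inf_le_right : D ⊓ J ≤ J) hr.symm
  rw [H.rk_bot, hr, Nat.sub_zero] at hcard
  rw [hr, ← hz] at hcard'
  have hfilter : (layer rk ⊥ J i).filter (fun J' => D ⊓ J ≤ J') = layer rk (D ⊓ J) J i := by
    ext J'
    simp only [Finset.mem_filter, mem_layer, bot_le, true_and]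
    tauto
  have hsplit := Finset.card_filter_add_card_filter_not (s := layer rk ⊥ J i)
    (fun J' => D ⊓ J ≤ J')
  rw [hfilter] at hsplit
  have hsplit' := congrArg (Nat.cast (R := ℝ)) hsplit
  push_cast at hsplit'
  rw [hcard, hcard'] at hsplit'
  have hzd : z ≤ d := H.strictMono.monotone inf_le_left
  have hzi : z ≤ i + 1 := hr ▸ H.strictMono.monotone inf_le_right
  have hrk := H.rk_sup_add_rk_inf D J
  have hsup := H.strictMono.monotone (sup_le hD hK)
  set c := q ^ (i + 1) * qNum q (m - d) * qNum q (m - (i + 1)) with hc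
  -- For z = 0 the truncated z - 1 is harmless, as its factor [i + 1] - [i + 1 - z] vanishes.
  have hsum : ∑ J' ∈ layer rk ⊥ J i, gammaFlow q rk D K i J' J
      = qNum q (i + 1 - z) * (gammaCoeff q m (i + 1) z * q ^ (m - d + z) / c * qNum q (d - z))
        + (qNum q (i + 1) - qNum q (i + 1 - z)) *
          (gammaCoeff q m (i + 1) (z - 1) * q ^ (m - d + (z - 1)) / c
            * -(qNum q (m - i) - qNum q (d - (z - 1)))) := by
    rw [← Finset.sum_filter_add_sum_filter_not _ (fun J' => D ⊓ J ≤ J'),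
      Finset.sum_congr rfl (g := fun _ =>
        gammaCoeff q m (i + 1) z * q ^ (m - d + z) / c * qNum q (d - z)),
      Finset.sum_congr (s₁ := (layer rk ⊥ J i).filter (fun J' => ¬ D ⊓ J ≤ J')) rfl (g := fun _ =>
        gammaCoeff q m (i + 1) (z - 1) * q ^ (m - d + (z - 1)) / c
            * -(qNum q (m - i) - qNum q (d - (z - 1))))]
    · simp only [Finset.sum_const, nsmul_eq_mul]
      rw [hfilter, hcard']
      congr 2
      linarith
    · intro J' h
      obtain ⟨h1, h2⟩ := Finset.mem_filter.mp h
      obtain ⟨_, h4, h5⟩ := mem_layer.mp h1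
      have h6 := H.rk_inf_of_not_le h4 (by omega) h2
      have h7 : rk (D ⊓ J') = z - 1 := by omega
      rw [gammaFlow, if_neg h2, h7]
    · intro J' h
      obtain ⟨h1, h2⟩ := Finset.mem_filter.mp h
      obtain ⟨_, h4, _⟩ := mem_layer.mp h1
      rw [gammaFlow, if_pos h2, ← inf_eq_inf_of_inf_le h4 h2]
  rw [hsum]
  have hc0 : c ≠ 0 := mul_ne_zero (mul_ne_zero (pow_ne_zero _ hq.ne')
    (qNum_ne_zero hq (by omega))) (qNum_ne_zero hq (by omega))
  obtain ⟨j, hj⟩ := Nat.exists_eq_add_of_le hzi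
  obtain ⟨y, hy⟩ := Nat.exists_eq_add_of_le hzd
  -- x is the corank of D ⊔ J in K.
  obtain ⟨x, hx⟩ : ∃ x, m = d + (x + j) := ⟨m - d - j, by omega⟩
  have hid := qNum_add_mul_qNum_add q x j y
  rcases Nat.eq_zero_or_pos z with h0 | h0
  -- Here the corank bound on D is essential: if D ⊓ J = ⊥, it forces D ⊔ J = K.
  · have hx0 : x = 0 := by omega
    have e1 : i + 1 - z = j := by omega
    have e2 : m - d = j := by omega
    have e3 : m - (i + 1) = y := by omega
    have e4 : d - z = y := by omega
    have e5 : i + 1 = j := by omega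
    have hj0 := qNum_ne_zero hq (show 0 < j by omega)
    have hy0 := qNum_ne_zero hq (show 0 < y by omega)
    rw [hc, e1, e2, e3, e4, e5, h0]
    field_simp
    simp
  · obtain ⟨w, hw⟩ := Nat.exists_eq_add_of_lt h0
    have hw' : z = w + 1 := by omega
    have hrec := gammaCoeff_mul_qNum_succ hq (m := m) (i := i + 1) (z := w) (by omega) hi
    rw [← hw'] at hrec
    have e0 : z - 1 = w := by omega
    have e1 : i + 1 - z = j := by omega
    have e2 : m - d = x + j := by omega
    have e3 : m - (i + 1) = x + y := by omega
    have e4 : d - z = y := by omega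
    have e5 : d - w = y + 1 := by omega
    have e6 : m - i = y + 1 + x := by omega
    have e7 : m - z = x + y + j := by omega
    have e8 : i + 1 = j + z := by omega
    rw [e7] at hrec
    rw [e2, e3, e8] at hc
    rw [e0, e1, e2, e4, e5, e6, qNum_add q (y + 1) x, e8, qNum_add q j z]
    rw [e8] at hrec
    have hp : q ^ (j + z) = q ^ j * q ^ w * q := by rw [hw']; ring
    have hp' : q ^ (x + j + z) = q ^ (x + j + w) * q := by rw [hw']; ring
    rw [hp] at hc
    rw [hp']
    generalize gammaCoeff q m (j + z) z = g at *
    generalize gammaCoeff q m (j + z) w = g' at *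
    clear_value c
    -- After clearing c, `hrec` eliminates g' in favour of g, and `hid` remains.
    have hmul : (qNum q j * (g * (q ^ (x + j + w) * q) * qNum q y)
        + q ^ j * qNum q z * (g' * q ^ (x + j + w) * -(q ^ (y + 1) * qNum q x))) = g * c := by
      rw [hc]
      linear_combination (-(q ^ j * q ^ w * q) * qNum q x) * hrec
        - g * (q ^ j * q ^ w * q) * hid
    rw [eq_comm, ← eq_div_iff hc0] at hmul
    refine Eq.trans ?_ hmul.symm
    ring

/-- The sum of `γ(m, i, rk (D ⊓ J))` over the elements `J ≤ K` of rank `i` vanishes if `D < K` has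
corank at most `i` in `K`. -/
theorem sum_gammaCoeff_eq_zero [IsModularLattice L] (hq : 0 < q) (H : IsQGraded q rk) {D K : L} (hD : D ≤ K) {i : ℕ}
    (hi : i < rk K) (hlt : rk D < rk K) (hcodim : rk K ≤ rk D + i) :
    ∑ J ∈ layer rk ⊥ K i, gammaCoeff q (rk K) i (rk (D ⊓ J)) = 0 := by
  obtain ⟨i, rfl⟩ := Nat.exists_eq_add_one_of_ne_zero (show i ≠ 0 by omega)
  rw [← Finset.sum_congr rfl fun J hJ => H.sum_gammaFlow_lower hq hD hi hlt hcodim hJ,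
    sum_layer_comm]
  exact Finset.sum_eq_zero fun J' hJ' => H.sum_gammaFlow_upper hD hJ'

open Classical in
theorem sum_gammaCoeff [IsModularLattice L] (hq : 0 < q) (H : IsQGraded q rk) {W K : L} {i : ℕ}
    (hi : i ≤ rk K) (hcodim : rk K ≤ rk (W ⊓ K) + i) :
    ∑ J ∈ layer rk ⊥ K i, gammaCoeff q (rk K) i (rk (W ⊓ J)) = if K ≤ W then 1 else 0 := by
  have hKW : K ≤ W ↔ rk K ≤ rk (W ⊓ K) := by
    refine ⟨fun h => by rw [inf_eq_right.mpr h], fun h => ?_⟩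
    exact inf_eq_right.mp (H.eq_of_le inf_le_right h)
  rcases hi.eq_or_lt with rfl | hi
  · rw [H.layer_self ⊥ K bot_le, Finset.sum_singleton, gammaCoeff, if_pos rfl]
    have := H.strictMono.monotone (inf_le_right : W ⊓ K ≤ K)
    exact if_congr (by rw [hKW]; omega) rfl rfl
  have hinf : ∀ J ∈ layer rk ⊥ K i, W ⊓ J = (W ⊓ K) ⊓ J := fun J hJ => by
    rw [inf_assoc, inf_eq_right.mpr (mem_layer.mp hJ).2.1]
  by_cases h : K ≤ W
  -- If K ≤ W, every J meets W in J, so the terms are constant and equal to the reciprocal of their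
  -- number.
  · rw [if_pos h, Finset.sum_congr rfl (g := fun _ => 1 / qBinom q (rk K) i)]
    · rw [Finset.sum_const, nsmul_eq_mul, H.card_layer_bot hq K hi.le]
      exact mul_one_div_cancel
        (div_pos (qFalling_pos hq hi.le) (qFact_pos hq i)).ne'
    · intro J hJ
      obtain ⟨_, h1, h2⟩ := mem_layer.mp hJ
      rw [inf_eq_right.mpr (h1.trans h), h2, gammaCoeff_self_right hq hi]
  · rw [if_neg h, Finset.sum_congr rfl fun J hJ => by rw [hinf J hJ]]
    exact H.sum_gammaCoeff_eq_zero hq inf_le_right hi (by rw [hKW] at h; omega) hcodim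

end IsQGraded

/-! ### Uniqueness of weights and the theorem for q-graded lattices. -/

namespace IsQGraded

variable {L : Type*} [Lattice L] [Finite L] {q : ℝ} {rk : L → ℕ}

open Classical in
theorem sum_grass_ite_le [OrderBot L] (rk : L → ℕ) (i : ℕ) (K : L) (g : L → ℝ) :
    ∑ I : Grass rk i, g I.1 * (if I.1 ≤ K then 1 else 0) = ∑ J ∈ layer rk ⊥ K i, g J := by
  simp only [mul_ite, mul_one, mul_zero]
  rw [← Finset.sum_filter]
  refine Finset.sum_bij (fun I _ => I.1) ?_ (fun _ _ _ _ h => Subtype.ext h) ?_ fun _ _ => rfl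
  · intro I hI
    exact mem_layer.mpr ⟨bot_le, (Finset.mem_filter.mp hI).2, I.2⟩
  · intro J hJ
    obtain ⟨_, h1, h2⟩ := mem_layer.mp hJ
    exact ⟨⟨J, h2⟩, Finset.mem_filter.mpr ⟨Finset.mem_univ _, h1⟩, rfl⟩

theorem sum_smul_pencil_apply [OrderBot L] (rk : L → ℕ) (i k : ℕ) (g : L → ℝ) (K : Grass rk k) :
    (∑ I : Grass rk i, g I.1 • pencil rk k I.1) K = ∑ J ∈ layer rk ⊥ K.1 i, g J := by
  rw [← sum_grass_ite_le, Finset.sum_apply]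
  rfl

/-- Within an interval `[⊥, W]` of rank `m + i`, the inclusion matrix of ranks `i ≤ m` is
injective: its rows span, and it is square. -/
theorem eq_zero_of_sum_layer_eq_zero [OrderBot L] [IsModularLattice L] (hq : 0 < q) (H : IsQGraded q rk) {i m : ℕ}
    (him : i ≤ m) {W : L} (hW : rk W = m + i) (a : L → ℝ)
    (ha : ∀ K, K ≤ W → rk K = m → ∑ J ∈ layer rk ⊥ K i, a J = 0) {J : L} (hJ : J ≤ W)
    (hJi : rk J = i) : a J = 0 := by
  classical
  let A : Matrix (layer rk ⊥ W i) (layer rk ⊥ W m) ℝ := fun J K => if J.1 ≤ K.1 then 1 else 0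
  let B : Matrix (layer rk ⊥ W m) (layer rk ⊥ W i) ℝ :=
    fun U J => gammaCoeff q m i (rk (U.1 ⊓ J.1))
  have hcard : Fintype.card (layer rk ⊥ W m) = Fintype.card (layer rk ⊥ W i) := by
    rw [Fintype.card_coe, Fintype.card_coe, ← Nat.cast_inj (R := ℝ),
      H.card_layer_bot hq W (by omega), H.card_layer_bot hq W (by omega), hW,
      qBinom_add_symm hq]
  have hsum : ∀ (K : L), K ≤ W → ∀ g : L → ℝ,
      ∑ J : layer rk ⊥ W i, g J.1 * (if J.1 ≤ K then 1 else 0) = ∑ J ∈ layer rk ⊥ K i, g J := by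
    intro K hK g
    rw [Finset.sum_coe_sort (layer rk ⊥ W i) fun J => g J * (if J ≤ K then 1 else 0)]
    simp only [mul_ite, mul_one, mul_zero]
    rw [← Finset.sum_filter]
    congr 1
    ext J
    simp only [Finset.mem_filter, mem_layer]
    exact ⟨fun ⟨⟨h1, _, h3⟩, h4⟩ => ⟨h1, h4, h3⟩,
      fun ⟨h1, h2, h3⟩ => ⟨⟨h1, h2.trans hK, h3⟩, h2⟩⟩
  -- Two elements of rank m in an interval of rank m + i meet in rank at least m - i, so
  -- `sum_gammaCoeff` applies; for equal ranks K ≤ U means K = U.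
  have hBA : B * A = 1 := by
    ext U K
    obtain ⟨_, hK, hKm⟩ := mem_layer.mp K.2
    obtain ⟨_, hU, hUm⟩ := mem_layer.mp U.2
    have h1 := H.rk_sup_add_rk_inf U.1 K.1
    have h2 := H.strictMono.monotone (sup_le hU hK)
    have h3 := H.sum_gammaCoeff hq (W := U.1) (K := K.1) (i := i) (by omega) (by omega)
    rw [Matrix.mul_apply]
    refine (hsum K.1 hK fun J => gammaCoeff q m i (rk (U.1 ⊓ J))).trans ?_
    rw [hKm] at h3
    rw [h3, Matrix.one_apply]
    refine if_congr ⟨fun h => ?_, fun h => h ▸ le_rfl⟩ rfl rfl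
    exact Subtype.ext (H.eq_of_le h (by omega)).symm
  have hAB : A * B = 1 := (Matrix.mul_eq_one_comm_of_card_eq _ _ _ hcard).mp hBA
  have hv : Matrix.vecMul (fun J : layer rk ⊥ W i => a J.1) A = 0 := by
    ext K
    obtain ⟨_, hK, hKm⟩ := mem_layer.mp K.2
    exact (hsum K.1 hK a).trans (ha K.1 hK hKm)
  have h0 : (fun J : layer rk ⊥ W i => a J.1) = 0 := by
    rw [← Matrix.vecMul_one (fun J : layer rk ⊥ W i => a J.1), ← hAB, ← Matrix.vecMul_vecMul, hv,
      Matrix.zero_vecMul]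
  exact congrFun h0 ⟨J, mem_layer.mpr ⟨bot_le, hJ, hJi⟩⟩

theorem linearIndependent_pencil [BoundedOrder L] [IsModularLattice L] (hq : 0 < q) (H : IsQGraded q rk) {i m : ℕ}
    (him : i ≤ m) (hn : m + i ≤ rk (⊤ : L)) :
    LinearIndependent ℝ fun I : Grass rk i => pencil rk m I.1 := by
  classical
  rw [Fintype.linearIndependent_iff]
  intro a ha J
  let b : L → ℝ := fun U => if h : rk U = i then a ⟨U, h⟩ else 0
  have hb : ∀ I : Grass rk i, b I.1 = a I := fun I => dif_pos I.2
  -- The relations at K ≤ W involve only coefficients below W, so an interval containing J where the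
  -- matrix is square suffices.
  obtain ⟨W, hJW, _, hW⟩ := H.exists_le_rk_eq hq (le_top : J.1 ≤ ⊤) (r := m + i)
    (by rw [J.2]; omega) hn
  rw [← hb]
  refine H.eq_zero_of_sum_layer_eq_zero hq him hW b (fun K _ hK => ?_) hJW J.2
  rw [← sum_smul_pencil_apply rk i m b ⟨K, hK⟩]
  simp only [hb]
  rw [ha]
  rfl

theorem wt_sum_smul_pencil [BoundedOrder L] [IsModularLattice L] (hq : 0 < q) (H : IsQGraded q rk) {i m : ℕ}
    (him : i ≤ m) (hn : m + i ≤ rk (⊤ : L)) (a : Grass rk i → ℝ) :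
    wt rk i m (∑ I : Grass rk i, a I • pencil rk m I.1) = a := by
  have hmem : ∑ I : Grass rk i, a I • pencil rk m I.1 ∈ Vbar rk i m :=
    (Submodule.mem_span_range_iff_exists_fun ℝ).mpr ⟨a, rfl⟩
  exact ((H.linearIndependent_pencil hq him hn).fintypeLinearCombination_injective
    (by simpa [Fintype.linearCombination_apply] using sum_wt_smul_pencil rk i m _ hmem)).symm

theorem dualFun_mem_and_wt [BoundedOrder L] [IsModularLattice L] (hq : 0 < q) (H : IsQGraded q rk) {n i k : ℕ}
    (σ : L ≃o Lᵒᵈ) (hσ : ∀ U, rk (perp σ U) + rk U = n) (hk : k ≤ n) (hi : i ≤ min k (n - k))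
    (f : Grass rk k → ℝ) (hf : f ∈ Vbar rk i k) :
    dualFun σ hσ hk f ∈ Vbar rk i (n - k) ∧ ∀ J : Grass rk i,
      wt rk i (n - k) (dualFun σ hσ hk f) J
        = ∑ I : Grass rk i, gammaCoeff q (n - k) i (rk (perp σ I.1 ⊓ J.1)) * wt rk i k f I := by
  classical
  have htop : rk (⊤ : L) = n := by
    have h := hσ ⊥
    have h' : perp σ ⊥ = ⊤ := by simp [perp]
    rwa [h', H.rk_bot, add_zero] at h
  have key : dualFun σ hσ hk f = ∑ J : Grass rk i,
      (∑ I : Grass rk i, gammaCoeff q (n - k) i (rk (perp σ I.1 ⊓ J.1)) * wt rk i k f I)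
        • pencil rk (n - k) J.1 := by
    ext K
    rw [sum_smul_pencil_apply rk i (n - k) (fun J => ∑ I : Grass rk i,
      gammaCoeff q (n - k) i (rk (perp σ I.1 ⊓ J)) * wt rk i k f I), Finset.sum_comm]
    conv_lhs => rw [sum_wt_smul_pencil rk i k f hf]
    refine (Finset.sum_apply _ _ _).trans ?_
    refine Finset.sum_congr rfl fun I _ => ?_
    have h1 := hσ I.1
    have h2 := H.rk_sup_add_rk_inf (perp σ I.1) K.1
    have h3 := H.strictMono.monotone (le_top : perp σ I.1 ⊔ K.1 ≤ ⊤)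
    have h4 := I.2
    have h5 := K.2
    have h6 := H.sum_gammaCoeff hq (W := perp σ I.1) (K := K.1) (i := i) (by omega) (by omega)
    have h7 : K.1 ≤ perp σ I.1 ↔ I.1 ≤ perpInv σ K.1 := by
      conv_lhs => rw [← perp_perpInv σ K.1]
      exact OrderDual.ofDual_le_ofDual.trans (map_le_map_iff σ)
    rw [h5] at h6
    rw [← Finset.sum_mul, h6, mul_comm]
    simp only [h7]
    rfl
  refine ⟨?_, fun J => ?_⟩
  · rw [key]
    exact (Submodule.mem_span_range_iff_exists_fun ℝ).mpr ⟨_, rfl⟩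
  · rw [key, H.wt_sum_smul_pencil hq (by omega) (by omega)]

end IsQGraded

/-! ### Subsets and subspaces as q-graded lattices. -/

theorem qNum_one_left (n : ℕ) : qNum 1 n = n := by simp [qNum]

theorem isQGraded_cardRk (V : Type*) [Fintype V] [DecidableEq V] : IsQGraded 1 (cardRk V) where
  rk_bot := Finset.card_empty
  strictMono := Finset.card_strictMono
  rk_sup_add_rk_inf := Finset.card_union_add_card_inter
  card_layer_succ a b hab := by
    rw [qNum_one_left, ← Finset.card_sdiff_of_subset hab, Nat.cast_inj]
    symm
    refine Finset.card_bij (fun x _ => insert x a) ?_ ?_ ?_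
    · intro x hx
      obtain ⟨hxb, hxa⟩ := Finset.mem_sdiff.mp hx
      exact mem_layer.mpr ⟨Finset.subset_insert x a, Finset.insert_subset hxb hab,
        Finset.card_insert_of_notMem hxa⟩
    · intro x hx y hy h
      have : x ∈ insert y a := h ▸ Finset.mem_insert_self x a
      exact (Finset.mem_insert.mp this).resolve_right (Finset.mem_sdiff.mp hx).2
    · intro c hc
      obtain ⟨h1, h2, h3⟩ := mem_layer.mp hc
      obtain ⟨x, hx, rfl⟩ := Finset.covBy_iff_exists_insert.mp
        (Finset.covBy_iff_card_sdiff_eq_one.mpr ⟨h1, by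
          rw [Finset.card_sdiff_of_subset h1]; simp only [cardRk] at h3; omega⟩)
      exact ⟨x, Finset.mem_sdiff.mpr ⟨h2 (Finset.mem_insert_self x a), hx⟩, rfl⟩

/-- To count the covers of a inside b, map the vectors x of b outside a to a ⊔ ⟨x⟩. The fibre over c
is c minus a, of constant size q^(dim a + 1) - q^(dim a), so the number of covers is a quotient that
reduces to a q-number. -/
theorem isQGraded_dimRk (F V : Type*) [Field F] [Finite F] [AddCommGroup V] [Module F V]
    [Finite V] : IsQGraded (Nat.card F : ℝ) (dimRk F V) := by
  classical
  have : Module.Finite F V := Module.Finite.of_finite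
  have := Fintype.ofFinite V
  have hF : 1 < Nat.card F := Finite.one_lt_card
  have hcard (U : Submodule F V) : (Finset.univ.filter (· ∈ U)).card
      = Nat.card F ^ dimRk F V U := by
    rw [← Module.natCard_eq_pow_finrank (K := F) (V := U), Nat.card_eq_fintype_card,
      Fintype.card_subtype]
  refine ⟨finrank_bot F V, fun _ _ h => Submodule.finrank_lt_finrank_of_lt h,
    fun U W => Submodule.finrank_sup_add_finrank_inf_eq U W, fun a b hab => ?_⟩
  have hlt {x : V} (hx : x ∉ a) : a < a ⊔ Submodule.span F {x} :=
    lt_of_le_of_ne le_sup_left fun h =>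
      hx (h ▸ (le_sup_right : _ ≤ a ⊔ Submodule.span F {x}) (Submodule.mem_span_singleton_self x))
  have hrk {x : V} (hx : x ∉ a) : dimRk F V (a ⊔ Submodule.span F {x}) = dimRk F V a + 1 := by
    have h1 := Submodule.finrank_add_le_finrank_add_finrank a (Submodule.span F {x})
    have h2 := finrank_span_singleton (K := F) (v := x) fun h => hx (h ▸ a.zero_mem)
    have h3 := Submodule.finrank_lt_finrank_of_lt (hlt hx)
    simp only [dimRk]
    omega
  have hdiff {c : Submodule F V} (hc : a ≤ c) :
      (Finset.univ.filter (fun x => x ∈ c ∧ x ∉ a)).card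
        = Nat.card F ^ dimRk F V c - Nat.card F ^ dimRk F V a := by
    rw [← hcard, ← hcard, ← Finset.card_sdiff_of_subset
      (Finset.monotone_filter_right _ fun x _ hx => hc hx)]
    congr 1
    ext x
    simp
  have hfiber := Finset.card_eq_sum_card_fiberwise (f := fun x => a ⊔ Submodule.span F {x})
    (s := Finset.univ.filter (fun x => x ∈ b ∧ x ∉ a))
    (t := layer (dimRk F V) a b (dimRk F V a + 1)) (fun x hx => by
      obtain ⟨hxb, hxa⟩ := (Finset.mem_filter.mp hx).2
      exact mem_layer.mpr ⟨le_sup_left, sup_le hab (by simpa using hxb), hrk hxa⟩)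
  have hconst : ∀ c ∈ layer (dimRk F V) a b (dimRk F V a + 1),
      ((Finset.univ.filter (fun x => x ∈ b ∧ x ∉ a)).filter
        (fun x => a ⊔ Submodule.span F {x} = c)).card
        = Nat.card F ^ (dimRk F V a + 1) - Nat.card F ^ dimRk F V a := by
    intro c hc
    obtain ⟨h1, h2, h3⟩ := mem_layer.mp hc
    rw [← h3, ← hdiff h1]
    congr 1
    ext x
    simp only [Finset.mem_filter, Finset.mem_univ, true_and]
    constructor
    · rintro ⟨⟨_, hxa⟩, rfl⟩
      exact ⟨(le_sup_right : _ ≤ a ⊔ Submodule.span F {x})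
        (Submodule.mem_span_singleton_self x), hxa⟩
    · rintro ⟨hxc, hxa⟩
      exact ⟨⟨h2 hxc, hxa⟩, Submodule.eq_of_le_of_finrank_eq (sup_le h1 (by simpa using hxc))
        ((hrk hxa).trans h3.symm)⟩
  rw [Finset.sum_congr rfl hconst, Finset.sum_const, smul_eq_mul, hdiff hab] at hfiber
  have hle : dimRk F V a ≤ dimRk F V b := Submodule.finrank_mono hab
  obtain ⟨d, hd⟩ := Nat.exists_eq_add_of_le hle
  have hreal := congrArg (Nat.cast (R := ℝ)) hfiber
  rw [Nat.cast_mul, Nat.cast_sub (Nat.pow_le_pow_right (by omega) hle),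
    Nat.cast_sub (Nat.pow_le_pow_right (by omega) (Nat.le_succ _))] at hreal
  push_cast at hreal
  rw [hd] at hreal ⊢
  rw [Nat.add_sub_cancel_left]
  have hF' : (1 : ℝ) < Nat.card F := by exact_mod_cast hF
  have hne : ((Nat.card F : ℝ) - 1) * (Nat.card F : ℝ) ^ dimRk F V a ≠ 0 :=
    mul_ne_zero (by linarith) (pow_ne_zero _ (by linarith))
  refine mul_right_cancel₀ hne ?_
  have hgeom := sub_one_mul_qNum (Nat.card F : ℝ) d
  rw [pow_add, Nat.succ_eq_add_one] at hreal
  linear_combination -hreal - (Nat.card F : ℝ) ^ dimRk F V a * hgeom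

end DualWeights

open DualWeights
theorem theorem5p8 :
    -- the set case `q = 1`
    (∀ (V : Type*) [Fintype V] [DecidableEq V] (σ : Finset V ≃o (Finset V)ᵒᵈ) (n i k : ℕ)
      (hn : Fintype.card V = n) (hk : k ≤ n), i ≤ min k (n - k) →
      ∀ f ∈ Vbar (cardRk V) i k,
        dualFun σ (fun U => (cardRk_perp_add σ U).trans hn) hk f ∈ Vbar (cardRk V) i (n - k) ∧
        ∀ J : Grass (cardRk V) i,
          wt (cardRk V) i (n - k)
              (dualFun σ (fun U => (cardRk_perp_add σ U).trans hn) hk f) J =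
            ∑ I : Grass (cardRk V) i,
              gammaCoeff 1 (n - k) i (cardRk V (perp σ I.1 ⊓ J.1)) * wt (cardRk V) i k f I) ∧
    -- the `q`-analog case
    (∀ (F V : Type*) [Field F] [Finite F] [AddCommGroup V] [Module F V] [Finite V]
      (σ : Submodule F V ≃o (Submodule F V)ᵒᵈ) (n i k : ℕ)
      (hn : Module.finrank F V = n) (hk : k ≤ n), i ≤ min k (n - k) →
      ∀ f ∈ Vbar (dimRk F V) i k,
        dualFun σ (fun U => (dimRk_perp_add σ U).trans hn) hk f ∈ Vbar (dimRk F V) i (n - k) ∧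
        ∀ J : Grass (dimRk F V) i,
          wt (dimRk F V) i (n - k)
              (dualFun σ (fun U => (dimRk_perp_add σ U).trans hn) hk f) J =
            ∑ I : Grass (dimRk F V) i,
              gammaCoeff (Nat.card F) (n - k) i (dimRk F V (perp σ I.1 ⊓ J.1)) *
                wt (dimRk F V) i k f I) := by
  refine ⟨?_, ?_⟩
  · intro V _ _ σ n i k hn hk hi f hf
    exact (isQGraded_cardRk V).dualFun_mem_and_wt one_pos σ _ hk hi f hf
  · intro F V _ _ _ _ _ σ n i k hn hk hi f hf
    exact (isQGraded_dimRk F V).dualFun_mem_and_wt (Nat.cast_pos.mpr Nat.card_pos) σ _ hk hi f hf
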